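/- Let $\mathbb F_\infty$ be the free group on generators $\{g_i\}_{i\in\mathbb Z}$, let $\lambda$ be its left regular representation on $\ell^2(\mathbb F_\infty)$, $\lambda(s)\delta_t=\delta_{st}$, and let $C^*_\lambda(\mathbb F_\infty)\subset B(\ell^2(\mathbb F_\infty))$ be the norm closure of $\mathrm{span}\{\lambda(s):s\in\mathbb F_\infty\}$. Let $\beta$ be the automorphism of $\mathbb F_\infty$ with $\beta(g_i)=g_{i+1}$ for all $i\in\mathbb Z$, let $\alpha_\beta$ be the induced automorphism of $C^*_\lambda(\mathbb F_\infty)$, $\alpha_\beta(\lambda(s))=\lambda(\beta(s))$, and let $\tau(x)=\langle x\delta_1,\delta_1\rangle$ be the canonical trace. Then $(C^*_\lambda(\mathbb F_\infty),\tau,\alpha_\beta)$ is strictly weak mixing. That is, $\tau$ is a state, $\alpha_\beta$ is a unital completely positive map with $\tau\circ\alpha_\beta=\tau$, and $$\lim_{n\to\infty}\frac1n\sum_{k=0}^{n-1}\bigl|\psi(\alpha_\beta^k(x))-\psi(\mathbf 1)\tau(x)\bigr|=0$$ for all $x\in C^*_\lambda(\mathbb F_\infty)$ and all bounded linear functionals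 $\psi$ on $C^*_\lambda(\mathbb F_\infty)$. Moreover, for every $s\ne 1$ in $\mathbb F_\infty$ of reduced word length $p$, every sequence $(k_j)_{j\ge1}$ of pairwise distinct natural numbers and every $n\ge1$, $$\Bigl\|\frac1n\sum_{j=1}^{n}\alpha_\beta^{k_j}(\lambda(s))\Bigr\|\le\frac{p+1}{\sqrt n}.$$ -/

import Mathlib

open Filter Topology

noncomputable section

namespace StrictWeakMixing

section DynamicalSystems

variable {A : Type*} [CStarAlgebra A]

open scoped ComplexOrder in
/-- A state on a unital C*-algebra: a Hermitian positive normalised functional. The order on `ℂ` is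
the one for which `0 ≤ z` means that `z` is real and non-negative. -/
structure IsState (φ : StrongDual ℂ A) : Prop where
  map_star : ∀ x : A, φ (star x) = star (φ x)
  nonneg : ∀ x : A, 0 ≤ φ (star x * x)
  map_one : φ 1 = 1

/-- A unital completely positive map: every amplification to matrices sends positive elements
(those of the form `y* y`) to positive elements, and `T 1 = 1`. -/
structure IsUcp (T : A →ₗ[ℂ] A) : Prop where
  map_one : T 1 = 1
  map_matrix : ∀ (n : ℕ) (M : Matrix (Fin n) (Fin n) A),
    (∃ Y : Matrix (Fin n) (Fin n) A, M = Y.conjTranspose * Y) →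
      ∃ Z : Matrix (Fin n) (Fin n) A, M.map T = Z.conjTranspose * Z

/-- `(A, φ, T)` is a state preserving C*-dynamical system. -/
structure IsStatePreserving (φ : StrongDual ℂ A) (T : A →ₗ[ℂ] A) : Prop where
  state : IsState φ
  ucp : IsUcp T
  invariant : ∀ x : A, φ (T x) = φ x

/-- `(A, φ, T)` is a strictly weak mixing state preserving C*-dynamical system. -/
structure IsStrictlyWeakMixing (φ : StrongDual ℂ A) (T : A →ₗ[ℂ] A) : Prop
    extends IsStatePreserving φ T where
  tendsto : ∀ (x : A) (ψ : StrongDual ℂ A),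
    Tendsto (fun n : ℕ => (1 / (n : ℝ)) * ∑ k ∈ Finset.range n, ‖ψ ((T ^ k) x) - ψ 1 * φ x‖)
      atTop (𝓝 0)

end DynamicalSystems

section Permutations

/-- The Hilbert space `ℓ²(α)`. -/
abbrev ell2 (α : Type*) : Type _ := lp (fun _ : α => ℂ) 2

variable {α : Type*}

open Classical in
/-- The unit vector `δ_t` of `ℓ²(α)`. -/
def delta (t : α) : ell2 α := lp.single 2 t (1 : ℂ)

theorem memlp_comp (e : Equiv.Perm α) (f : ell2 α) :
    Memℓp (fun a => (f : α → ℂ) (e a)) 2 := by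
  have h2 : 0 < (2 : ENNReal).toReal := by norm_num
  rw [memℓp_gen_iff h2]
  exact (e.summable_iff (f := fun a => ‖(f : α → ℂ) a‖ ^ (2 : ENNReal).toReal)).2
    ((memℓp_gen_iff h2).1 (lp.memℓp f))

/-- The isometric automorphism of `ℓ²(α)` that a permutation `e` of `α` induces,
`(U_e f)(a) = f (e⁻¹ a)`, so that `U_e δ_t = δ_{e t}`. -/
def permIso (e : Equiv.Perm α) : ell2 α ≃ₗᵢ[ℂ] ell2 α where
  toFun f := ⟨fun a => (f : α → ℂ) (e⁻¹ a), memlp_comp e⁻¹ f⟩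
  invFun f := ⟨fun a => (f : α → ℂ) (e a), memlp_comp e f⟩
  map_add' _ _ := rfl
  map_smul' _ _ := rfl
  left_inv f := by ext a; simp
  right_inv f := by ext a; simp
  norm_map' f := by
    have h2 : 0 < (2 : ENNReal).toReal := by norm_num
    simp only [lp.norm_eq_tsum_rpow h2]
    congr 1
    exact Equiv.tsum_eq (e⁻¹ : Equiv.Perm α)
      (fun a => ‖(f : α → ℂ) a‖ ^ (2 : ENNReal).toReal)

/-- The unitary representation `e ↦ U_e` of the permutations of `α` on `ℓ²(α)`. -/
def permUnitary : Equiv.Perm α →* unitary (ell2 α →L[ℂ] ell2 α) where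
  toFun e := Unitary.linearIsometryEquiv.symm (permIso e)
  map_one' := by
    ext f
    rfl
  map_mul' e e' := by
    ext f
    rfl

theorem permUnitary_apply (e : Equiv.Perm α) (f : ell2 α) (a : α) :
    ((permUnitary e : ell2 α →L[ℂ] ell2 α) f : α → ℂ) a = (f : α → ℂ) (e⁻¹ a) := rfl

end Permutations

section ReducedGroupAlgebra

variable (G : Type*) [Group G]

/-- The left regular representation of `G` on `ℓ²(G)`. -/
def regularRep : G →* unitary (ell2 G →L[ℂ] ell2 G) :=
  permUnitary.comp (MulAction.toPermHom G G)

/-- The reduced group C*-algebra of `G`: the norm closure of the *-algebra generated by the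
operators `λ(s)`, which is the closure of their linear span (`coe_reducedCStar` below). -/
def reducedCStar : StarSubalgebra ℂ (ell2 G →L[ℂ] ell2 G) :=
  (StarAlgebra.adjoin ℂ
    (Set.range fun s : G => (regularRep G s : ell2 G →L[ℂ] ell2 G))).topologicalClosure

instance isClosed_reducedCStar :
    IsClosed ((reducedCStar G : StarSubalgebra ℂ (ell2 G →L[ℂ] ell2 G)) :
      Set (ell2 G →L[ℂ] ell2 G)) :=
  StarSubalgebra.isClosed_topologicalClosure _

variable {G}

theorem regularRep_apply_delta (s t : G) :
    (regularRep G s : ell2 G →L[ℂ] ell2 G) (delta t) = delta (s * t) := by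
  classical
  ext a
  change (delta t : G → ℂ) (s⁻¹ * a) = (delta (s * t) : G → ℂ) a
  simp only [delta, lp.coeFn_single, Pi.single_apply]
  congr 1
  simp only [inv_mul_eq_iff_eq_mul]

theorem star_regularRep (s : G) :
    star (regularRep G s : ell2 G →L[ℂ] ell2 G) = regularRep G s⁻¹ := by
  rw [map_inv]; rfl

theorem coe_reducedCStar :
    (reducedCStar G : Set (ell2 G →L[ℂ] ell2 G)) =
      closure (Submodule.span ℂ
        (Set.range fun s : G => (regularRep G s : ell2 G →L[ℂ] ell2 G)) :
          Set (ell2 G →L[ℂ] ell2 G)) := by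
  set R : Set (ell2 G →L[ℂ] ell2 G) :=
    Set.range fun s : G => (regularRep G s : ell2 G →L[ℂ] ell2 G) with hR
  have hstar : star R = R := by
    ext x
    constructor
    · rintro ⟨s, hs⟩
      refine ⟨s⁻¹, ?_⟩
      have := congrArg star hs
      simp only [star_regularRep, star_star] at this
      exact this
    · rintro ⟨s, rfl⟩
      exact ⟨s⁻¹, (star_regularRep s).symm⟩
  have hmon : (Submonoid.closure R : Set (ell2 G →L[ℂ] ell2 G)) = R := by
    refine Set.Subset.antisymm ?_ Submonoid.subset_closure
    intro x hx
    refine Submonoid.closure_induction (motive := fun x _ => x ∈ R) (fun x h => h)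
      ⟨1, by simp⟩ ?_ hx
    rintro _ _ _ _ ⟨s, rfl⟩ ⟨t, rfl⟩
    exact ⟨s * t, by simp⟩
  have key : ((StarAlgebra.adjoin ℂ R : StarSubalgebra ℂ (ell2 G →L[ℂ] ell2 G)) :
      Set (ell2 G →L[ℂ] ell2 G)) = (Submodule.span ℂ R : Set _) := by
    have h := StarAlgebra.adjoin_toSubalgebra ℂ R
    rw [hstar, Set.union_self] at h
    have h' := Algebra.adjoin_eq_span ℂ R
    rw [← h, hmon] at h'
    exact congrArg (fun p : Submodule ℂ (ell2 G →L[ℂ] ell2 G) =>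
      (p : Set (ell2 G →L[ℂ] ell2 G))) h'
  rw [reducedCStar, StarSubalgebra.topologicalClosure_coe, key]

/-- `λ(s)` as an element of the reduced group C*-algebra. -/
def lam (s : G) : reducedCStar G :=
  ⟨regularRep G s, StarSubalgebra.le_topologicalClosure _
    (StarAlgebra.subset_adjoin ℂ _ ⟨s, rfl⟩)⟩

/-- The canonical trace `x ↦ ⟨x δ_1, δ_1⟩` (linear in `x`). -/
def canonicalTrace : StrongDual ℂ (reducedCStar G) :=
  ((innerSL ℂ (delta (1 : G))).comp
    (ContinuousLinearMap.apply ℂ (ell2 G) (delta (1 : G)))).comp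
      (Subalgebra.toSubmodule (reducedCStar G).toSubalgebra).subtypeL

theorem canonicalTrace_apply (x : reducedCStar G) :
    canonicalTrace x = inner ℂ (delta (1 : G)) ((x : ell2 G →L[ℂ] ell2 G) (delta 1)) := rfl

/-- Conjugation by the unitary `U_β` of `ℓ²(G)`, `U_β δ_t = δ_{β t}`. -/
def conjAut (β : G ≃* G) : (ell2 G →L[ℂ] ell2 G) ≃⋆ₐ[ℂ] (ell2 G →L[ℂ] ell2 G) :=
  Unitary.conjStarAlgAut ℂ _ (permUnitary β.toEquiv)

theorem conjAut_regularRep (β : G ≃* G) (s : G) :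
    conjAut β (regularRep G s : ell2 G →L[ℂ] ell2 G) = regularRep G (β s) := by
  have hperm : (β.toEquiv : Equiv.Perm G) * MulAction.toPermHom G G s * β.toEquiv⁻¹ =
      MulAction.toPermHom G G (β s) := by
    ext a
    change β (s * β.symm a) = β s * a
    simp
  have h := congrArg permUnitary hperm
  rw [map_mul, map_mul, map_inv] at h
  exact congrArg Subtype.val h

theorem conjAut_symm (β : G ≃* G) : (conjAut β).symm = conjAut β.symm := by
  rw [conjAut, Unitary.conjStarAlgAut_symm, Unitary.star_eq_inv, ← map_inv]
  rfl

theorem conjAut_mem (β : G ≃* G) {x : ell2 G →L[ℂ] ell2 G} (hx : x ∈ reducedCStar G) :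
    conjAut β x ∈ reducedCStar G := by
  have hcont : Continuous (conjAut β) := by
    change Continuous fun x => (permUnitary β.toEquiv : ell2 G →L[ℂ] ell2 G) * x *
      (star (permUnitary β.toEquiv) : ell2 G →L[ℂ] ell2 G)
    fun_prop
  have hle : reducedCStar G ≤ (reducedCStar G).comap (conjAut β : _ →⋆ₐ[ℂ] _) := by
    refine StarSubalgebra.topologicalClosure_minimal ?_
      ((isClosed_reducedCStar G).preimage hcont)
    refine StarAlgebra.adjoin_le ?_
    rintro _ ⟨s, rfl⟩
    change conjAut β (regularRep G s : ell2 G →L[ℂ] ell2 G) ∈ reducedCStar G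
    rw [conjAut_regularRep]
    exact (lam (β s)).2
  exact hle hx

/-- The automorphism `α_β` of the reduced group C*-algebra induced by an automorphism `β` of the
group, `α_β (λ(s)) = λ(β s)` (`reducedAut_lam` below). -/
def reducedAut (β : G ≃* G) : reducedCStar G ≃⋆ₐ[ℂ] reducedCStar G where
  toFun x := ⟨conjAut β x, conjAut_mem β x.2⟩
  invFun x := ⟨(conjAut β).symm x, by rw [conjAut_symm]; exact conjAut_mem β.symm x.2⟩
  left_inv x := Subtype.ext (by simp)
  right_inv x := Subtype.ext (by simp)
  map_mul' x y := Subtype.ext (by simp)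
  map_add' x y := Subtype.ext (by simp)
  map_star' x := Subtype.ext (by simp [map_star])
  map_smul' c x := Subtype.ext (by simp)

theorem reducedAut_lam (β : G ≃* G) (s : G) : reducedAut β (lam s) = lam (β s) :=
  Subtype.ext (conjAut_regularRep β s)

end ReducedGroupAlgebra

section FreeShift

/-- The free group on generators `g_i`, `i ∈ ℤ`. -/
abbrev FInf : Type := FreeGroup ℤ

/-- The shift automorphism of the free group, `g_i ↦ g_{i+1}`. -/
def shift : FInf ≃* FInf := FreeGroup.freeGroupCongr (Equiv.addRight (1 : ℤ))

theorem shift_of (i : ℤ) : shift (FreeGroup.of i) = FreeGroup.of (i + 1) := by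
  simp [shift]

/-- The free shift of the reduced C*-algebra of the free group on infinitely many generators. -/
def freeShift : reducedCStar FInf ≃⋆ₐ[ℂ] reducedCStar FInf := reducedAut shift

/-- The free shift as a linear map. -/
def freeShiftLin : reducedCStar FInf →ₗ[ℂ] reducedCStar FInf where
  toFun := freeShift
  map_add' := map_add freeShift
  map_smul' := map_smul freeShift

end FreeShift

end StrictWeakMixing

end

/-! Let the reduced word of `s ≠ 1` begin with a letter `g_a^{±1}` and end with `g_b^{±1}`. If the
reduced word of `t` does not begin with `g_b^{±1}`, nothing cancels in `st`, so `st` begins with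
`g_a^{±1}`. Hence `λ(s) = λ(s) P + Q λ(s) (1 - P)`, where `P` and `Q` project onto the words
beginning in `g_b^{±1}` and in `g_a^{±1}` (`regularRep_eq_add`, `mul_mem_startsWith`).

Distinct powers of the shift move `a` and `b` to distinct indices, so both families of projections
are orthogonal. Cauchy–Schwarz then bounds each half of a sum of `n` shifts by `√n`, and the whole
by `2√n`, even with coefficients of modulus at most one (`norm_sum_smul_shift_le`). Since `s` has
length `p ≥ 1`, `2 ≤ p + 1` gives the norm estimate.

Taking phases as coefficients puts the absolute values inside `ψ`, so the averages for `λ(s)` are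
`O(1/√n)`. Density of the span of the `λ(s)` and a bound uniform in `n` extend the limit to the
whole algebra. -/

noncomputable section

namespace StrictWeakMixing

/-! ### Coordinate projections of `ℓ²` and square root bounds for sums. -/

section Restriction

variable {α ι : Type*}

theorem memlp_indicator (C : Set α) (f : ell2 α) : Memℓp (C.indicator (f : α → ℂ)) 2 :=
  (lp.memℓp f).mono' fun _ => norm_indicator_le_norm_self _ _

/-- The restriction of a square summable function to a set, extended by zero, as a linear map. -/
def restrictLin (C : Set α) : ell2 α →ₗ[ℂ] ell2 α where
  toFun f := ⟨C.indicator (f : α → ℂ), memlp_indicator C f⟩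
  map_add' f g := Subtype.ext (Set.indicator_add C (f : α → ℂ) (g : α → ℂ))
  map_smul' c f := Subtype.ext (Set.indicator_const_smul C c (f : α → ℂ))

theorem norm_restrictLin_le (C : Set α) (f : ell2 α) : ‖restrictLin C f‖ ≤ 1 * ‖f‖ := by
  rw [one_mul]
  exact lp.norm_mono (by norm_num) fun _ => norm_indicator_le_norm_self _ _

/-- The restriction of a square summable function to a set, extended by zero, as an operator. -/
def restrict (C : Set α) : ell2 α →L[ℂ] ell2 α :=
  (restrictLin C).mkContinuous 1 (norm_restrictLin_le C)

theorem restrict_apply (C : Set α) (f : ell2 α) (a : α) :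
    (restrict C f : α → ℂ) a = C.indicator (f : α → ℂ) a := rfl

theorem ell2_hasSum_norm_sq (f : ell2 α) :
    HasSum (fun a => ‖(f : α → ℂ) a‖ ^ 2) (‖f‖ ^ 2) := by
  have h := lp.hasSum_norm (p := 2) (by norm_num) f
  simpa using h

theorem star_restrict (C : Set α) : star (restrict C) = restrict C := by
  rw [ContinuousLinearMap.star_eq_adjoint, eq_comm, ContinuousLinearMap.eq_adjoint_iff]
  intro f g
  rw [lp.inner_eq_tsum, lp.inner_eq_tsum]
  refine tsum_congr fun a => ?_
  rw [restrict_apply, restrict_apply]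
  by_cases h : a ∈ C <;> simp [h]

/-- Bessel's inequality, proved pointwise: at each `a` at most one summand is nonzero. -/
theorem sum_norm_sq_restrict_le (J : Finset ι) {C : ι → Set α}
    (hC : Pairwise (Function.onFun Disjoint C)) (f : ell2 α) :
    ∑ j ∈ J, ‖restrict (C j) f‖ ^ 2 ≤ ‖f‖ ^ 2 := by
  have h := hasSum_sum fun j (_ : j ∈ J) => ell2_hasSum_norm_sq (restrict (C j) f)
  refine hasSum_le (fun a => ?_) h (ell2_hasSum_norm_sq f)
  by_cases ha : ∃ i ∈ J, a ∈ C i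
  · obtain ⟨i, hi, hai⟩ := ha
    rw [Finset.sum_eq_single_of_mem i hi, restrict_apply, Set.indicator_of_mem hai]
    intro j _ hji
    rw [restrict_apply, Set.indicator_of_notMem, norm_zero, zero_pow two_ne_zero]
    exact fun haj => Set.disjoint_left.1 (hC hji) haj hai
  · push Not at ha
    rw [Finset.sum_eq_zero]
    · positivity
    · intro j hj
      rw [restrict_apply, Set.indicator_of_notMem (ha j hj), norm_zero, zero_pow two_ne_zero]

/-- Cauchy–Schwarz over `J` costs `√|J|`; orthogonality of the pieces of `f` absorbs the rest. The
ranges of the `U j` may overlap. -/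
theorem norm_sum_mul_restrict_le (J : Finset ι) {C : ι → Set α}
    (hC : Pairwise (Function.onFun Disjoint C)) (U : ι → ell2 α →L[ℂ] ell2 α)
    (hU : ∀ j, ‖U j‖ ≤ 1) :
    ‖∑ j ∈ J, U j * restrict (C j)‖ ≤ √(J.card : ℝ) := by
  refine ContinuousLinearMap.opNorm_le_bound _ (Real.sqrt_nonneg _) fun f => ?_
  have h1 : ‖(∑ j ∈ J, U j * restrict (C j)) f‖ ≤ ∑ j ∈ J, ‖restrict (C j) f‖ := by
    rw [sum_apply]
    refine norm_sum_le_of_le _ fun j _ => ?_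
    exact ((U j).le_of_opNorm_le (hU j) _).trans_eq (one_mul _)
  refine h1.trans (le_of_sq_le_sq ?_ (by positivity))
  calc (∑ j ∈ J, ‖restrict (C j) f‖) ^ 2
      ≤ J.card * ∑ j ∈ J, ‖restrict (C j) f‖ ^ 2 := sq_sum_le_card_mul_sum_sq
    _ ≤ J.card * ‖f‖ ^ 2 := by gcongr; exact sum_norm_sq_restrict_le J hC f
    _ = (√(J.card : ℝ) * ‖f‖) ^ 2 := by rw [mul_pow, Real.sq_sqrt (by positivity)]

/-- The adjoint of the preceding bound. -/
theorem norm_sum_restrict_mul_le (J : Finset ι) {D : ι → Set α}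
    (hD : Pairwise (Function.onFun Disjoint D)) (U : ι → ell2 α →L[ℂ] ell2 α)
    (hU : ∀ j, ‖U j‖ ≤ 1) :
    ‖∑ j ∈ J, restrict (D j) * U j‖ ≤ √(J.card : ℝ) := by
  rw [← norm_star, star_sum]
  simp only [star_mul, star_restrict]
  exact norm_sum_mul_restrict_le J hD (fun j => star (U j)) fun j =>
    (norm_star (U j)).trans_le (hU j)

theorem norm_one_sub_restrict_le (C : Set α) : ‖(1 : ell2 α →L[ℂ] ell2 α) - restrict C‖ ≤ 1 := by
  refine ContinuousLinearMap.opNorm_le_bound _ zero_le_one fun f => ?_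
  rw [one_mul]
  refine lp.norm_mono (by norm_num) fun a => ?_
  change ‖(f : α → ℂ) a - C.indicator (f : α → ℂ) a‖ ≤ ‖(f : α → ℂ) a‖
  by_cases h : a ∈ C <;> simp [h]

end Restriction

/-! ### The regular representation, the trace and the induced automorphisms. -/

section RegularRepresentation

variable {G ι : Type*} [Group G]

theorem norm_regularRep_le (s : G) : ‖(regularRep G s : ell2 G →L[ℂ] ell2 G)‖ ≤ 1 :=
  ContinuousLinearMap.opNorm_le_bound _ zero_le_one fun f => by
    rw [one_mul]
    exact ((permIso (MulAction.toPermHom G G s)).norm_map f).le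

/-- Vectors supported off `C` are sent to vectors supported in `D`, so inserting `restrict D` on
that part changes nothing. -/
theorem regularRep_eq_add {s : G} {C D : Set G} (h : ∀ t, t ∉ C → s * t ∈ D) :
    (regularRep G s : ell2 G →L[ℂ] ell2 G) =
      regularRep G s * restrict C + restrict D * (regularRep G s * (1 - restrict C)) := by
  ext f a
  change (f : G → ℂ) (s⁻¹ * a) = C.indicator (f : G → ℂ) (s⁻¹ * a) +
    D.indicator (fun b => (f : G → ℂ) (s⁻¹ * b) - C.indicator (f : G → ℂ) (s⁻¹ * b)) a
  by_cases ha : s⁻¹ * a ∈ C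
  · by_cases haD : a ∈ D <;> simp [ha, haD]
  · have := h _ ha
    rw [mul_inv_cancel_left] at this
    simp [ha, this]

theorem norm_sum_smul_regularRep_le (J : Finset ι) (s : ι → G) (c : ι → ℂ)
    (hc : ∀ j, ‖c j‖ ≤ 1) {C D : ι → Set G} (hC : Pairwise (Function.onFun Disjoint C))
    (hD : Pairwise (Function.onFun Disjoint D)) (h : ∀ j t, t ∉ C j → s j * t ∈ D j) :
    ‖∑ j ∈ J, c j • (regularRep G (s j) : ell2 G →L[ℂ] ell2 G)‖ ≤ 2 * √(J.card : ℝ) := by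
  have key : ∑ j ∈ J, c j • (regularRep G (s j) : ell2 G →L[ℂ] ell2 G) =
      ∑ j ∈ J, (c j • (regularRep G (s j) : ell2 G →L[ℂ] ell2 G)) * restrict (C j) +
      ∑ j ∈ J, restrict (D j) *
        (c j • ((regularRep G (s j) : ell2 G →L[ℂ] ell2 G) * (1 - restrict (C j)))) := by
    rw [← Finset.sum_add_distrib]
    refine Finset.sum_congr rfl fun j _ => ?_
    rw [smul_mul_assoc, mul_smul_comm, ← smul_add, ← regularRep_eq_add (h j)]
  have hU : ∀ j, ‖c j • (regularRep G (s j) : ell2 G →L[ℂ] ell2 G)‖ ≤ 1 := fun j => by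
    rw [norm_smul]
    exact mul_le_one₀ (hc j) (norm_nonneg _) (norm_regularRep_le _)
  rw [key, two_mul]
  refine norm_add_le_of_le (norm_sum_mul_restrict_le J hC _ hU)
    (norm_sum_restrict_mul_le J hD _ fun j => ?_)
  rw [← smul_mul_assoc]
  exact (norm_mul_le _ _).trans (mul_le_one₀ (hU j) (norm_nonneg _) (norm_one_sub_restrict_le _))

theorem canonicalTrace_lam {s : G} (hs : s ≠ 1) : canonicalTrace (lam s) = 0 := by
  classical
  rw [canonicalTrace_apply]
  change inner ℂ (delta (1 : G)) ((regularRep G s : ell2 G →L[ℂ] ell2 G) (delta 1)) = 0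
  rw [regularRep_apply_delta, mul_one]
  simp [delta, lp.inner_single_left, hs.symm]

open scoped ComplexOrder in
theorem isState_canonicalTrace : IsState (canonicalTrace (G := G)) where
  map_star x := by
    rw [canonicalTrace_apply, canonicalTrace_apply]
    change inner ℂ (delta (1 : G)) (star (x : ell2 G →L[ℂ] ell2 G) (delta 1)) = _
    rw [ContinuousLinearMap.star_eq_adjoint, ContinuousLinearMap.adjoint_inner_right]
    exact (inner_conj_symm _ _).symm
  nonneg x := by
    rw [canonicalTrace_apply]
    change 0 ≤ inner ℂ (delta (1 : G)) (star (x : ell2 G →L[ℂ] ell2 G)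
      ((x : ell2 G →L[ℂ] ell2 G) (delta 1)))
    rw [ContinuousLinearMap.star_eq_adjoint, ContinuousLinearMap.adjoint_inner_right,
      inner_self_eq_norm_sq_to_K]
    change (0 : ℂ) ≤ ((‖(x : ell2 G →L[ℂ] ell2 G) (delta 1)‖ : ℝ) : ℂ) ^ 2
    rw [← Complex.ofReal_pow]
    exact Complex.zero_le_real.2 (sq_nonneg _)
  map_one := by
    classical
    rw [canonicalTrace_apply]
    change inner ℂ (delta (1 : G)) (delta 1) = 1
    simp [delta]

/-- `α_β` is conjugation by `U_β`, and `U_β` and its inverse fix `δ_1` because automorphisms fix the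
identity. -/
theorem canonicalTrace_reducedAut (β : G ≃* G) (x : reducedCStar G) :
    canonicalTrace (reducedAut β x) = canonicalTrace x := by
  have hU : ∀ γ : G ≃* G, permIso γ.toEquiv (delta (1 : G)) = delta 1 := fun γ => by
    classical
    ext a
    change (delta (1 : G) : G → ℂ) (γ.symm a) = (delta (1 : G) : G → ℂ) a
    simp only [delta, lp.coeFn_single, Pi.single_apply, EmbeddingLike.map_eq_one_iff]
  rw [canonicalTrace_apply, canonicalTrace_apply]
  have hx : ((reducedAut β x : reducedCStar G) : ell2 G →L[ℂ] ell2 G) (delta 1) =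
      permIso β.toEquiv ((x : ell2 G →L[ℂ] ell2 G) (permIso β.symm.toEquiv (delta 1))) := by
    change conjAut β x (delta 1) = _
    rw [conjAut, Unitary.conjStarAlgAut_apply, ← Unitary.coe_star, Unitary.star_eq_inv, ← map_inv]
    rfl
  rw [hx, hU β.symm]
  nth_rw 1 [← hU β]
  exact LinearIsometryEquiv.inner_map_map _ _ _

theorem norm_reducedAut (β : G ≃* G) (x : reducedCStar G) : ‖reducedAut β x‖ = ‖x‖ :=
  StarAlgEquiv.norm_map (reducedAut β) x

theorem span_lam_dense :
    Dense (Submodule.span ℂ (Set.range (lam : G → reducedCStar G)) : Set (reducedCStar G)) := by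
  intro x
  have himg : Subtype.val '' (Submodule.span ℂ (Set.range (lam : G → reducedCStar G)) :
      Set (reducedCStar G)) = (Submodule.span ℂ
        (Set.range fun s : G => (regularRep G s : ell2 G →L[ℂ] ell2 G)) : Set _) := by
    have h := Submodule.map_span (Subalgebra.toSubmodule (reducedCStar G).toSubalgebra).subtype
      (Set.range (lam : G → reducedCStar G))
    rw [← Set.range_comp] at h
    exact congrArg (fun p : Submodule ℂ (ell2 G →L[ℂ] ell2 G) =>
      (p : Set (ell2 G →L[ℂ] ell2 G))) h
  rw [closure_subtype, himg, ← coe_reducedCStar]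
  exact x.2

end RegularRepresentation

/-! ### First letters of reduced words. -/

section FreeGroupWords

variable {α β : Type*} [DecidableEq α] [DecidableEq β]

/-- Injective renaming of generators creates no new cancelling pair, so the renamed word is still
reduced. -/
theorem toWord_map_of_injective {f : α → β} (hf : Function.Injective f) (x : FreeGroup α) :
    (FreeGroup.map f x).toWord = x.toWord.map fun p => (f p.1, p.2) := by
  conv_lhs => rw [← FreeGroup.mk_toWord (x := x), FreeGroup.map.mk, FreeGroup.toWord_mk]
  refine FreeGroup.IsReduced.reduce_eq ?_
  rw [FreeGroup.IsReduced, List.isChain_map]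
  exact FreeGroup.isReduced_toWord.imp fun a b h h' => h (hf h')

/-- The elements whose reduced word begins with the generator `i` or its inverse. -/
def startsWith (i : α) : Set (FreeGroup α) := {t | t.toWord.head?.map Prod.fst = some i}

theorem disjoint_startsWith {i j : α} (h : i ≠ j) : Disjoint (startsWith i) (startsWith j) :=
  Set.disjoint_left.2 fun _ hi hj => h (Option.some_injective _ (hi.symm.trans hj))

/-- The letters meeting at the junction involve different generators, so the concatenated word is
already reduced and keeps the first letter of `s`. -/
theorem mul_mem_startsWith {s t : FreeGroup α} {i j : α}
    (hi : s.toWord.head?.map Prod.fst = some i)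
    (hj : s.toWord.getLast?.map Prod.fst = some j) (ht : t ∉ startsWith j) :
    s * t ∈ startsWith i := by
  have hred : FreeGroup.IsReduced (s.toWord ++ t.toWord) := by
    rw [FreeGroup.IsReduced, List.isChain_append]
    refine ⟨FreeGroup.isReduced_toWord, FreeGroup.isReduced_toWord, fun x hx y hy hxy => ?_⟩
    refine absurd ?_ ht
    rw [Option.mem_def] at hx hy
    rw [hx] at hj
    change t.toWord.head?.map Prod.fst = some j
    rw [hy, ← hj, Option.map_some, Option.map_some, hxy]
  change (s * t).toWord.head?.map Prod.fst = some i
  rw [FreeGroup.toWord_mul, hred.reduce_eq, List.head?_append_of_ne_nil]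
  · exact hi
  · rintro h
    simp [h] at hi

end FreeGroupWords

/-! ### Square root bounds for the free shift, and strict weak mixing. -/

section Mixing

theorem freeShiftLin_pow_lam (k : ℕ) (s : FInf) :
    (freeShiftLin ^ k) (lam s) = lam (FreeGroup.map (fun i : ℤ => i + k) s) := by
  induction k with
  | zero => simp
  | succ k ih =>
    rw [pow_succ', Module.End.mul_apply, ih]
    change reducedAut shift _ = _
    rw [reducedAut_lam]
    congr 1
    change FreeGroup.map _ _ = _
    rw [FreeGroup.map.comp]
    congr 2
    funext i
    simp [add_assoc]

theorem norm_sum_smul_shift_le {s : FInf} (hs : s ≠ 1) {k : ℕ → ℕ} (hk : Function.Injective k)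
    (c : ℕ → ℂ) (hc : ∀ j, ‖c j‖ ≤ 1) (n : ℕ) :
    ‖∑ j ∈ Finset.range n, c j • (freeShiftLin ^ k j) (lam s)‖ ≤ 2 * √(n : ℝ) := by
  have hw : s.toWord ≠ [] := fun h => hs (FreeGroup.toWord_eq_nil_iff.1 h)
  have hinj : ∀ m : ℕ, Function.Injective fun i : ℤ => i + m := fun m => add_left_injective _
  -- Injectivity of `k` makes the translated indices `i + k j` distinct; this serves both the last
  -- letter (domains) and the first letter (ranges).
  have hdis : ∀ i : ℤ,
      Pairwise (Function.onFun Disjoint fun j : ℕ => startsWith (i + (k j : ℤ))) :=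
    fun i j j' hjj => disjoint_startsWith fun h => hjj (hk (by simpa using h))
  have h := norm_sum_smul_regularRep_le (Finset.range n)
    (fun j => FreeGroup.map (fun i : ℤ => i + k j) s) c hc
    (hdis (s.toWord.getLast hw).1) (hdis (s.toWord.head hw).1) fun j t ht =>
      mul_mem_startsWith (by simp [toWord_map_of_injective (hinj _), List.head?_eq_some_head hw])
        (by simp [toWord_map_of_injective (hinj _), List.getLast?_eq_some_getLast hw]) ht
  rw [Finset.card_range] at h
  refine le_trans (le_of_eq ?_) h
  have hcoe : ∀ y : reducedCStar FInf,
      ‖y‖ = ‖(Subalgebra.toSubmodule (reducedCStar FInf).toSubalgebra).subtype y‖ := fun _ => rfl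
  rw [hcoe, map_sum]
  simp only [freeShiftLin_pow_lam]
  rfl

/-- A *-homomorphism applied entrywise is again a *-homomorphism on matrices, so it carries `Y* Y`
to `e(Y)* e(Y)`. -/
theorem isUcp_of_starAlgEquiv {A : Type*} [CStarAlgebra A] (T : A →ₗ[ℂ] A) (e : A ≃⋆ₐ[ℂ] A)
    (h : ∀ x, T x = e x) : IsUcp T where
  map_one := by rw [h, map_one]
  map_matrix n M := by
    rintro ⟨Y, rfl⟩
    refine ⟨Y.map e, ?_⟩
    ext i j
    simp [Matrix.mul_apply, h, map_star]

/-- The averages whose convergence to zero is asserted by strict weak mixing. -/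
def mixingAverage (ψ : StrongDual ℂ (reducedCStar FInf)) (x : reducedCStar FInf) (n : ℕ) : ℝ :=
  (1 / (n : ℝ)) * ∑ k ∈ Finset.range n, ‖ψ ((freeShiftLin ^ k) x) - ψ 1 * canonicalTrace x‖

theorem mixingAverage_nonneg (ψ : StrongDual ℂ (reducedCStar FInf)) (x : reducedCStar FInf)
    (n : ℕ) : 0 ≤ mixingAverage ψ x n := by
  unfold mixingAverage; positivity

theorem mixingAverage_add_le (ψ : StrongDual ℂ (reducedCStar FInf)) (x y : reducedCStar FInf)
    (n : ℕ) : mixingAverage ψ (x + y) n ≤ mixingAverage ψ x n + mixingAverage ψ y n := by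
  unfold mixingAverage
  rw [← mul_add, ← Finset.sum_add_distrib]
  gcongr with k _
  refine (le_of_eq ?_).trans (norm_add_le _ _)
  congr 1
  rw [map_add, map_add, map_add]
  ring

theorem mixingAverage_smul (ψ : StrongDual ℂ (reducedCStar FInf)) (c : ℂ) (x : reducedCStar FInf)
    (n : ℕ) : mixingAverage ψ (c • x) n = ‖c‖ * mixingAverage ψ x n := by
  unfold mixingAverage
  rw [mul_left_comm ‖c‖, Finset.mul_sum _ _ ‖c‖]
  congr 1
  refine Finset.sum_congr rfl fun k _ => ?_
  rw [← norm_mul]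
  congr 1
  rw [map_smul, map_smul, map_smul, smul_eq_mul, smul_eq_mul]
  ring

theorem norm_freeShiftLin_pow (k : ℕ) (x : reducedCStar FInf) :
    ‖(freeShiftLin ^ k) x‖ = ‖x‖ := by
  induction k with
  | zero => simp
  | succ k ih =>
    rw [pow_succ', Module.End.mul_apply, ← ih]
    exact norm_reducedAut shift _

/-- Uniformity in `n`, from the shift being isometric, is what the density argument needs. -/
theorem mixingAverage_le (ψ : StrongDual ℂ (reducedCStar FInf)) (x : reducedCStar FInf)
    (n : ℕ) :
    mixingAverage ψ x n ≤
      (‖ψ‖ + ‖ψ 1‖ * ‖canonicalTrace (G := FInf)‖) * ‖x‖ := by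
  unfold mixingAverage
  have hB : ∀ k ∈ Finset.range n, ‖ψ ((freeShiftLin ^ k) x) - ψ 1 * canonicalTrace x‖ ≤
      (‖ψ‖ + ‖ψ 1‖ * ‖canonicalTrace (G := FInf)‖) * ‖x‖ := fun k _ => by
    refine (norm_sub_le _ _).trans ?_
    rw [add_mul, norm_mul, mul_assoc]
    gcongr
    · exact (ψ.le_opNorm _).trans_eq (by rw [norm_freeShiftLin_pow])
    · exact ContinuousLinearMap.le_opNorm _ _
  have h := Finset.sum_le_card_nsmul (Finset.range n) _ _ hB
  rw [Finset.card_range, nsmul_eq_mul] at h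
  rcases n.eq_zero_or_pos with rfl | hn
  · simp only [Finset.range_zero, Finset.sum_empty, mul_zero]; positivity
  · rw [one_div, inv_mul_le_iff₀ (by positivity)]
    exact h

theorem tendsto_mixingAverage_lam (ψ : StrongDual ℂ (reducedCStar FInf)) (s : FInf) :
    Tendsto (mixingAverage ψ (lam s)) atTop (𝓝 0) := by
  by_cases hs : s = 1
  · have h1 : (lam (1 : FInf)) = 1 := Subtype.ext (by simp [lam])
    have hx : (canonicalTrace (1 : reducedCStar FInf)) = 1 := isState_canonicalTrace.map_one
    have : mixingAverage ψ (lam s) = fun _ => 0 := by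
      funext n
      unfold mixingAverage
      rw [Finset.sum_eq_zero, mul_zero]
      intro k _
      rw [hs, freeShiftLin_pow_lam, map_one, h1, hx, mul_one, sub_self, norm_zero]
    rw [this]
    exact tendsto_const_nhds
  · have hbound : ∀ n : ℕ, mixingAverage ψ (lam s) n ≤ ‖ψ‖ * 2 * (√(n : ℝ))⁻¹ := fun n => by
      unfold mixingAverage
      simp only [canonicalTrace_lam hs, mul_zero, sub_zero]
      -- With these phases as coefficients, the sum of the `|ψ(α^j λ(s))|` becomes `ψ` of one linear
      -- combination, of norm at most `2√n`.
      have hphase : ∀ z : ℂ, ∃ c : ℂ, ‖c‖ ≤ 1 ∧ c * z = (‖z‖ : ℂ) := fun z => by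
        by_cases hz : z = 0
        · exact ⟨0, by simp, by simp [hz]⟩
        · refine ⟨‖z‖ / z, ?_, by field_simp⟩
          rw [norm_div, Complex.norm_real, norm_norm, div_self (norm_ne_zero_iff.2 hz)]
      choose φ hφ1 hφ2 using hphase
      have h := norm_sum_smul_shift_le hs Function.injective_id
        (fun j => φ (ψ ((freeShiftLin ^ j) (lam s)))) (fun j => hφ1 _) n
      have h2 := ψ.le_of_opNorm_le_of_le le_rfl h
      simp only [map_sum, map_smul, smul_eq_mul, id, hφ2] at h2
      rw [← Complex.ofReal_sum, Complex.norm_real, Real.norm_of_nonneg (by positivity)] at h2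
      -- For `n = 0` both sides vanish, since division by zero gives zero.
      rcases n.eq_zero_or_pos with rfl | hn
      · simp
      have hn' : (0 : ℝ) < n := by exact_mod_cast hn
      rw [one_div, inv_mul_le_iff₀ hn']
      refine h2.trans_eq ?_
      have : (n : ℝ) * (√(n : ℝ))⁻¹ = √n := by
        rw [← div_eq_mul_inv, Real.div_sqrt]
      rw [mul_left_comm (n : ℝ), this, mul_assoc]
    refine squeeze_zero (mixingAverage_nonneg ψ _) hbound ?_
    have : Tendsto (fun n : ℕ => (√(n : ℝ))⁻¹) atTop (𝓝 0) :=
      (Real.tendsto_sqrt_atTop.comp tendsto_natCast_atTop_atTop).inv_tendsto_atTop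
    simpa using this.const_mul (‖ψ‖ * 2)

/-- The averages form a sequence of seminorms in `x`, uniformly dominated by the norm, so the
elements where they tend to zero form a closed subspace; it contains every `λ(s)`. -/
theorem tendsto_mixingAverage (ψ : StrongDual ℂ (reducedCStar FInf)) (x : reducedCStar FInf) :
    Tendsto (mixingAverage ψ x) atTop (𝓝 0) := by
  have hspan : ∀ y ∈ Submodule.span ℂ (Set.range (lam : FInf → reducedCStar FInf)),
      Tendsto (mixingAverage ψ y) atTop (𝓝 0) := fun y hy => by
    induction hy using Submodule.span_induction with
    | mem y hy => obtain ⟨s, rfl⟩ := hy; exact tendsto_mixingAverage_lam ψ s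
    | zero =>
      refine squeeze_zero (mixingAverage_nonneg ψ _) (mixingAverage_le ψ 0) ?_
      simp
    | add y z _ _ hy hz =>
      refine squeeze_zero (mixingAverage_nonneg ψ _) (mixingAverage_add_le ψ y z) ?_
      simpa using hy.add hz
    | smul c y _ hy =>
      rw [show mixingAverage ψ (c • y) = fun n => ‖c‖ * mixingAverage ψ y n from
        funext (mixingAverage_smul ψ c y)]
      simpa using hy.const_mul ‖c‖
  set K : ℝ := ‖ψ‖ + ‖ψ 1‖ * ‖canonicalTrace (G := FInf)‖ with hK
  have hK0 : 0 ≤ K := by positivity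
  rw [Metric.tendsto_atTop]
  intro ε hε
  -- The denominator is `K + 1` because `K` may be zero.
  obtain ⟨y, hy, hxy⟩ := Metric.dense_iff.1 span_lam_dense x (ε / 2 / (K + 1)) (by positivity)
  obtain ⟨N, hN⟩ := Metric.tendsto_atTop.1 (hspan _ hxy) (ε / 2) (by positivity)
  refine ⟨N, fun n hn => ?_⟩
  have h1 := hN n hn
  rw [Real.dist_0_eq_abs, abs_of_nonneg (mixingAverage_nonneg ψ _ _)] at h1 ⊢
  have h2 := mixingAverage_add_le ψ (x - y) y n
  rw [sub_add_cancel] at h2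
  have h3 := mixingAverage_le ψ (x - y) n
  rw [Metric.mem_ball, dist_comm, dist_eq_norm, lt_div_iff₀ (by positivity)] at hy
  have : K * ‖x - y‖ ≤ ‖x - y‖ * (K + 1) := by nlinarith [norm_nonneg (x - y)]
  linarith

theorem isStrictlyWeakMixing_freeShift :
    IsStrictlyWeakMixing (canonicalTrace (G := FInf)) freeShiftLin where
  state := isState_canonicalTrace
  ucp := isUcp_of_starAlgEquiv freeShiftLin freeShift fun _ => rfl
  invariant := canonicalTrace_reducedAut shift
  tendsto x ψ := tendsto_mixingAverage ψ x

theorem norm_average_shift_le {s : FInf} (hs : s ≠ 1) {k : ℕ → ℕ} (hk : Function.Injective k)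
    {n : ℕ} (hn : 0 < n) :
    ‖(1 / (n : ℂ)) • ∑ j ∈ Finset.range n, (freeShiftLin ^ k j) (lam s)‖
      ≤ ((s.norm : ℝ) + 1) / √n := by
  have h := norm_sum_smul_shift_le hs hk (fun _ => 1) (fun _ => by simp) n
  simp only [one_smul] at h
  -- A nontrivial word has length at least one, so `2 ≤ p + 1`.
  have hp : (1 : ℝ) ≤ s.norm := by
    exact_mod_cast Nat.one_le_iff_ne_zero.2 fun h0 => hs (FreeGroup.norm_eq_zero.1 h0)
  have hn' : (0 : ℝ) < n := by exact_mod_cast hn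
  rw [norm_smul, norm_div, norm_one, Complex.norm_natCast, one_div, inv_mul_le_iff₀ hn',
    mul_div_left_comm, Real.div_sqrt]
  exact h.trans (by gcongr; linarith)

end Mixing

end StrictWeakMixing

end

theorem mainTheorem5 :
    StrictWeakMixing.IsStrictlyWeakMixing
        (StrictWeakMixing.canonicalTrace (G := StrictWeakMixing.FInf))
        StrictWeakMixing.freeShiftLin ∧
      ∀ s : StrictWeakMixing.FInf, s ≠ 1 →
        ∀ (k : ℕ → ℕ), Function.Injective k → ∀ n : ℕ, 0 < n →
          ‖(1 / (n : ℂ)) • ∑ j ∈ Finset.range n,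
              (StrictWeakMixing.freeShiftLin ^ k j) (StrictWeakMixing.lam s)‖
            ≤ ((s.norm : ℝ) + 1) / Real.sqrt n :=
  ⟨StrictWeakMixing.isStrictlyWeakMixing_freeShift,
    fun _ hs _ hk _ hn => StrictWeakMixing.norm_average_shift_le hs hk hn⟩
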